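/- For a group $H$ let $\mathcal K(H,2)$ be the kernel of the homomorphism $H^2\to H^{\rm ab}$, $(h_1,h_2)\mapsto\overline{h_1h_2}$. For a group $G$ with a presentation $G\cong F/N$, $F$ a free group, let $\widetilde{\mathcal K}(G,2)=\mathcal K(F,2)/\langle\langle\mathcal K(N,2)\rangle\rangle$, where $\langle\langle\mathcal K(N,2)\rangle\rangle$ is the normal closure of $\mathcal K(N,2)$ in $F^2$; up to isomorphism this does not depend on the presentation. A cover of a finite group $G$ is a group $G^\ast$ for which there is a central short exact sequence $1\to M\to G^\ast\to G\to1$ with $M\le[G^\ast,G^\ast]$ and $M$ isomorphic to the Schur multiplier $H^2(G,\mathbb C^\ast)$ (trivial action). If $G$ is a finite abelian group and $\widetilde{\mathcal K}(G,2)$ is a cover of $G$, then $G$ is said to have a natural cover, and $\widetilde{\mathcal K}(G,2)$ is called the natural cover of $G$. A $p$-group is called extra-special if its centre is cyclic and is equal to both its commutator subgroup and its Frattini subgroup. **Proposition 4.5.** Let $p$ be an odd prime number. 1. $\mathbb Z/p\mathbb Z$ has a natural cover, and it is isomorphic to $\mathbb Z/p\mathbb Z$ itself. 2. $(\mathbb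 Z/p\mathbb Z)^2$ has a natural cover, and it is the extra-special group of order $p^{1+2}$ and exponent $p$: it is extra-special of order $p^{3}$ and exponent $p$, and every extra-special $p$-group of order $p^3$ and exponent $p$ is isomorphic to it. -/

import Mathlib

/-- The homomorphism `ψ : H ^ n → H^ab`, `(h₁, …, hₙ) ↦` the class of `h₁ ⋯ hₙ`. The class of the
product is written as the product of the classes, taken in the commutative group `H^ab`. -/
def psiHom (H : Type*) [Group H] (n : ℕ) : (Fin n → H) →* Abelianization H where
  toFun h := ∏ i, Abelianization.of (h i)
  map_one' := by simp
  map_mul' g h := by simp [Finset.prod_mul_distrib]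

/-- `K(H, n)`, the kernel of `ψ : H ^ n → H^ab`. -/
def KGroup (H : Type*) [Group H] (n : ℕ) : Subgroup (Fin n → H) :=
  (psiHom H n).ker

/-- For a subgroup `N` of `F`, the group `K(N, n)` (formed with the abelianisation of `N` itself),
seen as a subgroup of `F ^ n` through the inclusion `N ^ n ⊆ F ^ n`. -/
def KGroupIn {F : Type*} [Group F] (N : Subgroup F) (n : ℕ) : Subgroup (Fin n → F) :=
  (KGroup N n).map (N.subtype.compLeft (Fin n))

/-- The normal closure of `K(N, n)` inside `F ^ n`. -/
def KClosure {F : Type*} [Group F] (N : Subgroup F) (n : ℕ) : Subgroup (Fin n → F) :=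
  Subgroup.normalClosure (KGroupIn N n : Set (Fin n → F))

instance KClosure_normal {F : Type*} [Group F] (N : Subgroup F) (n : ℕ) :
    (KClosure N n).Normal :=
  Subgroup.normalClosure_normal

/-- The normal closure of `K(N, n)` in `F ^ n` lies in `K(F, n)`, so that `KTilde` below is the
quotient of `K(F, n)` by all of it. -/
theorem KClosure_le {F : Type*} [Group F] (N : Subgroup F) (n : ℕ) :
    KClosure N n ≤ KGroup F n := by
  have : (KGroup F n).Normal := MonoidHom.normal_ker _
  refine Subgroup.normalClosure_le_normal ?_
  rintro _ ⟨x, hx, rfl⟩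
  have hx' : ∏ i, Abelianization.of (x i) = 1 := hx
  have h := congrArg (Abelianization.map N.subtype) hx'
  rw [map_prod, map_one] at h
  exact h

/-- `K̃(G, n) = K(F, n) / ≪K(N, n)≫`, computed from a presentation `φ : F → G` with kernel `N`
(that is, `F` is free and `φ` is surjective). -/
abbrev KTilde {F G : Type*} [Group F] [Group G] (φ : F →* G) (n : ℕ) : Type _ :=
  KGroup F n ⧸ (KClosure φ.ker n).subgroupOf (KGroup F n)

/-- The Schur multiplier `M(G) = H²(G, ℂˣ)`, for the trivial action of `G` on `ℂˣ`. -/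
abbrev SchurMultiplier (G : Type) [Group G] : Type :=
  groupCohomology.H2 (Rep.trivial ℤ G (Additive ℂˣ))

/-- `E` is a cover of the finite group `G`: there is a central short exact sequence
`1 → M → E → G → 1` with `M ≤ [E, E]` and with `M` isomorphic to the Schur multiplier of `G`. -/
def IsCover (E : Type*) [Group E] (G : Type) [Group G] [Finite G] : Prop :=
  ∃ π : E →* G, Function.Surjective π ∧ π.ker ≤ Subgroup.center E ∧ π.ker ≤ commutator E ∧
    Nonempty (π.ker ≃* Multiplicative (SchurMultiplier G))

/-- `E` is a special `p`-group: its centre is equal to its commutator subgroup and to its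
Frattini subgroup. -/
def IsSpecialGroup (p : ℕ) (E : Type*) [Group E] : Prop :=
  IsPGroup p E ∧ Subgroup.center E = commutator E ∧ Subgroup.center E = frattini E

/-- `E` is an extra-special `p`-group: it is special and its centre is cyclic. -/
def IsExtraSpecialGroup (p : ℕ) (E : Type*) [Group E] : Prop :=
  IsSpecialGroup p E ∧ IsCyclic (Subgroup.center E)

/-! Let `G = F/N` be abelian. The first component gives a surjection `proj` from `K̃(G, 2)` to `G`.
Since the pairs `(n, n⁻¹)` with `n ∈ N` die, every element of its kernel is the class of some `(1,
c)` with `c ∈ [F, F]`; since `(1, [f, n])` dies too, this kernel is central and is a quotient of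
`[F, F]/[F, N]`. If `x, y` map to generators of `G`, the kernel is therefore generated by the class
of `(1, [x, y])`. It is trivial for `G` cyclic.

For `G = (ℤ/p)²` the generator has order dividing `p`. It is nontrivial because `F`, being free,
maps to the Heisenberg group over `G`: a homomorphism `ψ` that makes `N` central satisfies
`ψ(h₀)ψ(h₁) = 1` on the normal closure of `K(N, 2)`, whereas `[ψ x, ψ y] ≠ 1`. The commutator of
`(x, x⁻¹)` and `(y, y⁻¹)` is the square of the generator, so for odd `p` the kernel lies in the
commutator subgroup.

On the side of the Schur multiplier, a cocycle is a coboundary exactly when it is symmetric, because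
abelian extensions by the divisible group `ℂˣ` split. With two generators `u, v`, the class of `f`
is thus determined by `f(u, v) - f(v, u)`, which for `(ℤ/p)²` ranges over the `p`-th roots of unity.
Finally, a group of order `p³`, exponent `p` and class two is the Heisenberg group, which gives
uniqueness. -/

open scoped commutatorElement

/-! ### Two-cocycles of abelian groups and divisible coefficients -/

/-- The cocycle condition for functions of two variables with trivial coefficients. -/
def IsTrivialCocycle {G A : Type*} [Mul G] [Add A] (f : G → G → A) : Prop :=
  ∀ x y z, f (x * y) z + f x y = f y z + f x (y * z)

/-- The underlying set `A × G` of the extension of `G` by `A` attached to a two-cocycle `f`. -/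
@[ext]
structure TwistedProd {G A : Type*} (f : G → G → A) where
  /-- The component in the kernel. -/
  fst : A
  /-- The component in the quotient. -/
  snd : G

namespace IsTrivialCocycle

variable {G A : Type*} [CommGroup G] [AddCommGroup A] {f : G → G → A}

theorem one_left (hf : IsTrivialCocycle f) (x : G) : f 1 x = f 1 1 := by
  have := hf 1 1 x
  simp only [one_mul] at this
  exact (add_left_cancel this).symm

/-- The abelian extension attached to a symmetric two-cocycle. -/
abbrev twistedAddCommGroup (hf : IsTrivialCocycle f) (hs : ∀ x y, f x y = f y x) :
    AddCommGroup (TwistedProd f) :=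
  letI : Add (TwistedProd f) := ⟨fun u v ↦ ⟨u.fst + v.fst + f u.snd v.snd, u.snd * v.snd⟩⟩
  -- The cocycle is not normalised: the constant value `f 1 x = f 1 1` need not vanish, and the zero
  -- element compensates for it.
  letI : Zero (TwistedProd f) := ⟨⟨-f 1 1, 1⟩⟩
  letI : Neg (TwistedProd f) := ⟨fun u ↦ ⟨-u.fst - f u.snd⁻¹ u.snd - f 1 1, u.snd⁻¹⟩⟩
  have add_def (u v : TwistedProd f) :
    u + v = ⟨u.fst + v.fst + f u.snd v.snd, u.snd * v.snd⟩ := rfl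
  have zero_def : (0 : TwistedProd f) = ⟨-f 1 1, 1⟩ := rfl
  { AddGroup.ofLeftAxioms
      (fun u v w ↦ by
        have := hf u.snd v.snd w.snd
        ext
        · simp only [add_def]
          calc _ = u.fst + v.fst + w.fst + (f (u.snd * v.snd) w.snd + f u.snd v.snd) := by abel
            _ = _ := by rw [this]; abel
        · simp only [add_def, mul_assoc])
      (fun u ↦ by
        ext
        · simp only [add_def, zero_def, hf.one_left]; abel
        · simp only [add_def, zero_def, one_mul])
      (fun u ↦ by
        ext
        · simp only [add_def, zero_def]; abel
        · simp only [add_def, zero_def, inv_mul_cancel]) with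
    add_comm := fun u v ↦ by
      ext
      · change u.fst + v.fst + f u.snd v.snd = v.fst + u.fst + f v.snd u.snd
        rw [hs, add_comm u.fst]
      · exact mul_comm u.snd v.snd }

/-- A symmetric two-cocycle with values in a divisible group is a coboundary. -/
theorem exists_cochain [DivisibleBy A ℤ] (hf : IsTrivialCocycle f)
    (hs : ∀ x y, f x y = f y x) : ∃ g : G → A, ∀ x y, g y - g (x * y) + g x = f x y := by
  let _ := hf.twistedAddCommGroup hs
  have add_def (u v : TwistedProd f) :
    u + v = ⟨u.fst + v.fst + f u.snd v.snd, u.snd * v.snd⟩ := rfl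
  let i : A →+ TwistedProd f := AddMonoidHom.mk' (fun a ↦ ⟨a - f 1 1, 1⟩) fun a b ↦ by
    ext
    · simp only [add_def]; abel
    · simp only [add_def, mul_one]
  have hi : Function.Injective i := fun a b h ↦ sub_left_injective (congrArg TwistedProd.fst h)
  -- A divisible group is injective, so `i` has a retraction; its values on the section `x ↦ (0, x)`
  -- form the cochain.
  obtain ⟨r, hr⟩ :=
    (Module.Baer.of_divisible A).extension_property_addMonoidHom i hi (AddMonoidHom.id A)
  refine ⟨fun x ↦ r ⟨0, x⟩, fun x y ↦ ?_⟩
  have h : (⟨0, x⟩ + ⟨0, y⟩ : TwistedProd f) = i (f x y) + ⟨0, x * y⟩ := by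
    ext
    · simp [add_def, i, hf.one_left]
    · simp [add_def, i]
  have h' := congrArg r h
  rw [map_add, map_add, show r (i (f x y)) = f x y from DFunLike.congr_fun hr _] at h'
  rw [sub_add_eq_add_sub, sub_eq_iff_eq_add, add_comm, h']

/-- For fixed second argument, the antisymmetrisation of a two-cocycle of a commutative group is
additive in the first. -/
def alternating (hf : IsTrivialCocycle f) (z : G) : G →* Multiplicative A :=
  MonoidHom.mk' (fun x ↦ Multiplicative.ofAdd (f x z - f z x)) fun x y ↦ by
    rw [← ofAdd_add]
    congr 1
    have h1 := hf x y z
    have h2 := hf z x y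
    have h3 := hf x z y
    rw [mul_comm z x] at h2
    rw [mul_comm z y] at h3
    have e1 : f (x * y) z = f y z + f x (y * z) - f x y := eq_sub_of_add_eq h1
    have e2 : f z (x * y) = f (x * z) y + f z x - f x y := by rw [h2]; abel
    have e3 : f (x * z) y = f z y + f x (y * z) - f x z := eq_sub_of_add_eq h3
    rw [e1, e2, e3]
    abel

theorem alternating_apply (hf : IsTrivialCocycle f) (z x : G) :
    hf.alternating z x = Multiplicative.ofAdd (f x z - f z x) := rfl

/-- A two-cocycle is symmetric as soon as it is so on a generating set. -/
theorem symm_of_closure (hf : IsTrivialCocycle f) {S : Set G} (hS : Subgroup.closure S = ⊤)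
    (h : ∀ x ∈ S, ∀ y ∈ S, f x y = f y x) (x y : G) : f x y = f y x := by
  have key (z : G) (hz : ∀ x ∈ S, f x z = f z x) (x : G) : f x z = f z x := by
    have : hf.alternating z = 1 := MonoidHom.eq_of_eqOn_dense hS fun x hx ↦ by
      simp [alternating_apply, hz x hx]
    have := DFunLike.congr_fun this x
    rw [alternating_apply] at this
    exact sub_eq_zero.mp (ofAdd_eq_one.mp this)
  exact key y (fun x hx ↦ (key x (fun y hy ↦ h y hy x hx) y).symm) x

end IsTrivialCocycle

noncomputable instance divisibleByIntUnits {K : Type*} [Field K] [IsAlgClosed K] :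
    DivisibleBy (Additive Kˣ) ℤ :=
  letI : DivisibleBy (Additive Kˣ) ℕ := divisibleByOfSMulRightSurj _ _ fun {n} hn u ↦ by
    obtain ⟨z, hz⟩ := IsAlgClosed.exists_pow_nat_eq (u.toMul : K) (Nat.pos_of_ne_zero hn)
    have hz0 : z ≠ 0 := by
      rintro rfl
      rw [zero_pow hn] at hz
      exact u.toMul.ne_zero hz.symm
    exact ⟨Additive.ofMul (Units.mk0 z hz0), Units.ext hz⟩
  AddGroup.divisibleByIntOfDivisibleByNat _

/-! ### Schur multipliers of cyclic groups and of `(ℤ/n)²` -/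

section SchurMultiplier

open groupCohomology

variable {G : Type} [CommGroup G]

theorem mem_cocycles₂_trivial_iff {f : G × G → Additive ℂˣ} :
    f ∈ cocycles₂ (Rep.trivial ℤ G (Additive ℂˣ)) ↔ IsTrivialCocycle fun x y ↦ f (x, y) :=
  mem_cocycles₂_iff (A := Rep.trivial ℤ G (Additive ℂˣ)) f

/-- Symmetry propagates from generators, and the abelian extension attached to a symmetric cocycle
splits since `ℂˣ` is divisible. -/
theorem H2π_eq_zero_of_symm (f : cocycles₂ (Rep.trivial ℤ G (Additive ℂˣ)))
    {S : Set G} (hS : Subgroup.closure S = ⊤) (h : ∀ x ∈ S, ∀ y ∈ S, f (x, y) = f (y, x)) :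
    H2π (Rep.trivial ℤ G (Additive ℂˣ)) f = 0 := by
  rw [H2π_eq_zero_iff]
  have hf := mem_cocycles₂_trivial_iff.mp f.2
  obtain ⟨g, hg⟩ := hf.exists_cochain (hf.symm_of_closure hS h)
  exact ⟨g, funext fun x ↦ hg x.1 x.2⟩

theorem symm_of_H2π_eq_zero (f : cocycles₂ (Rep.trivial ℤ G (Additive ℂˣ)))
    (h : H2π (Rep.trivial ℤ G (Additive ℂˣ)) f = 0) (x y : G) : f (x, y) = f (y, x) := by
  rw [H2π_eq_zero_iff] at h
  obtain ⟨g, hg⟩ := h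
  have e (x y : G) : f (x, y) = g y - g (x * y) + g x := (congrFun hg (x, y)).symm
  rw [e, e, mul_comm y x]
  rw [sub_add_eq_add_sub, sub_add_eq_add_sub, add_comm]

theorem subsingleton_schurMultiplier_of_isCyclic [IsCyclic G] :
    Subsingleton (SchurMultiplier G) := by
  obtain ⟨g, hg⟩ := IsCyclic.exists_generator (α := G)
  have hS : Subgroup.closure {g} = ⊤ := by
    rw [← Subgroup.zpowers_eq_closure, Subgroup.eq_top_iff']; exact hg
  refine subsingleton_of_forall_eq 0 fun x ↦ ?_
  induction x using H2_induction_on with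
  | h f =>
    refine H2π_eq_zero_of_symm f hS ?_
    rintro _ rfl _ rfl
    rfl

/-- The difference `f (u, v) - f (v, u)` as a linear function of the two-cocycle `f`. -/
def antisymmetrization (u v : G) :
    cocycles₂ (Rep.trivial ℤ G (Additive ℂˣ)) →ₗ[ℤ] Additive ℂˣ where
  toFun f := f.1 (u, v) - f.1 (v, u)
  map_add' f g := add_sub_add_comm (f.1 (u, v)) (g.1 (u, v)) (f.1 (v, u)) (g.1 (v, u))
  map_smul' n f := (smul_sub n (f.1 (u, v)) (f.1 (v, u))).symm

theorem antisymmetrization_apply (u v : G) (f : cocycles₂ (Rep.trivial ℤ G (Additive ℂˣ))) :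
    antisymmetrization u v f = f.1 (u, v) - f.1 (v, u) := rfl

theorem ker_antisymmetrization {u v : G} (h : Subgroup.closure {u, v} = ⊤) :
    (antisymmetrization u v).ker = (H2π (Rep.trivial ℤ G (Additive ℂˣ))).hom.ker := by
  ext f
  rw [LinearMap.mem_ker, LinearMap.mem_ker, antisymmetrization_apply]
  refine ⟨fun hf ↦ H2π_eq_zero_of_symm f h ?_, fun hf ↦ ?_⟩
  · have := sub_eq_zero.mp hf
    rintro _ (rfl | rfl) _ (rfl | rfl)
    exacts [rfl, this, this.symm, rfl]
  · exact sub_eq_zero.mpr (symm_of_H2π_eq_zero f hf u v)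

/-- The antisymmetrisation and the projection to cohomology have the same kernel, hence equinumerous
images. -/
theorem card_schurMultiplier_eq {u v : G} (h : Subgroup.closure {u, v} = ⊤) :
    Nat.card (SchurMultiplier G) = Nat.card (antisymmetrization u v).range := by
  have hsurj : Function.Surjective (H2π (Rep.trivial ℤ G (Additive ℂˣ))).hom :=
    (ModuleCat.epi_iff_surjective _).mp inferInstance
  have hker : Setoid.ker (H2π (Rep.trivial ℤ G (Additive ℂˣ))).hom =
      Setoid.ker (antisymmetrization u v) := by
    ext f g
    rw [Setoid.ker_def, Setoid.ker_def, ← sub_eq_zero, ← map_sub, ← LinearMap.mem_ker,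
      ← ker_antisymmetrization h, LinearMap.mem_ker, map_sub, sub_eq_zero]
  have e1 := Setoid.quotientKerEquivOfSurjective _ hsurj
  rw [hker] at e1
  exact Nat.card_congr (e1.symm.trans (Setoid.quotientKerEquivRange (antisymmetrization u v)))

theorem closure_prod_zmod (n : ℕ) :
    Subgroup.closure {((.ofAdd 1, 1) : Multiplicative (ZMod n) × Multiplicative (ZMod n)),
      (1, .ofAdd 1)} = ⊤ := by
  rw [Subgroup.eq_top_iff']
  rintro ⟨a, b⟩
  obtain ⟨i, hi⟩ := ZMod.intCast_surjective a.toAdd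
  obtain ⟨j, hj⟩ := ZMod.intCast_surjective b.toAdd
  have : (a, b) = ((.ofAdd 1, 1) : Multiplicative (ZMod n) × Multiplicative (ZMod n)) ^ i *
      (1, .ofAdd 1) ^ j := by
    ext
    · simp [← ofAdd_zsmul, hi]
    · simp [← ofAdd_zsmul, hj]
  rw [this]
  exact mul_mem (zpow_mem (Subgroup.subset_closure (by simp)) _)
    (zpow_mem (Subgroup.subset_closure (by simp)) _)

/-- Antisymmetrisation is additive in the first argument, whose `n`-th power is trivial, so its
values are `n`-torsion. Conversely, bi-additive cocycles realise all of the torsion. -/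
theorem mem_range_antisymmetrization_iff (n : ℕ) (a : Additive ℂˣ) :
    a ∈ (antisymmetrization ((.ofAdd 1, 1) : Multiplicative (ZMod n) × Multiplicative (ZMod n))
      (1, .ofAdd 1)).range ↔ n • a = 0 := by
  constructor
  · rintro ⟨f, rfl⟩
    have hf := mem_cocycles₂_trivial_iff.mp f.2
    have h := map_pow (hf.alternating (1, .ofAdd 1)) (.ofAdd 1, 1) n
    have h1 : ((.ofAdd 1, 1) : Multiplicative (ZMod n) × Multiplicative (ZMod n)) ^ n = 1 := by
      ext <;> simp [← ofAdd_nsmul]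
    rw [h1, map_one] at h
    exact h.symm
  · intro ha
    -- The cocycle is `(x, y) ↦ l (x₁ y₂)`, where `l` sends `1` to `a`; it takes the value `a` on
    -- `(u, v)` and `0` on `(v, u)`.
    let l : ZMod n →+ Additive ℂˣ := ZMod.lift n ⟨zmultiplesHom _ a, by simpa using ha⟩
    have hl : l 1 = a := by
      have := ZMod.lift_coe n ⟨zmultiplesHom (Additive ℂˣ) a, by simpa using ha⟩ 1
      simpa using this
    refine ⟨⟨fun x ↦ l (x.1.1.toAdd * x.2.2.toAdd), mem_cocycles₂_trivial_iff.mpr ?_⟩, ?_⟩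
    · intro x y z
      simp only [← map_add]
      congr 1
      simp
      ring
    · rw [antisymmetrization_apply]
      change l (1 * 1) - l (0 * 0) = a
      simp [hl]

theorem card_schurMultiplier_prod_zmod (n : ℕ) [NeZero n] :
    Nat.card (SchurMultiplier (Multiplicative (ZMod n) × Multiplicative (ZMod n))) = n := by
  rw [card_schurMultiplier_eq (closure_prod_zmod n)]
  have e : (antisymmetrization
      ((.ofAdd 1, 1) : Multiplicative (ZMod n) × Multiplicative (ZMod n))
      (1, .ofAdd 1)).range ≃ rootsOfUnity n ℂ :=
    Equiv.subtypeEquiv Additive.toMul fun a ↦ by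
      rw [mem_range_antisymmetrization_iff, mem_rootsOfUnity]
      rfl
  rw [Nat.card_congr e, Complex.card_rootsOfUnity]

end SchurMultiplier

/-! ### Frattini subgroups and extra-special groups of order `p³` -/

section Frattini

open Subgroup

/-- The part of the center that consists of products of commutators lies in the Frattini
subgroup. -/
theorem center_inf_commutator_le_frattini (E : Type*) [Group E] :
    center E ⊓ commutator E ≤ frattini E := by
  refine le_iInf₂ fun M hM ↦ ?_
  by_cases h : center E ≤ M
  · exact inf_le_left.trans h
  -- Every element is then an element of the maximal subgroup `M` times a central one, so every
  -- commutator is a commutator of elements of `M`.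
  have htop : M ⊔ center E = ⊤ := hM.2 _ (left_lt_sup.mpr h)
  refine inf_le_right.trans (commutator_le.mpr fun g _ k _ ↦ ?_)
  obtain ⟨m, hm, z, hz, rfl⟩ := mem_sup_of_normal_right.mp (htop ▸ mem_top g)
  obtain ⟨n, hn, w, hw, rfl⟩ := mem_sup_of_normal_right.mp (htop ▸ mem_top k)
  have hz' := mem_center_iff.mp hz
  have hw' := mem_center_iff.mp hw
  have e : ⁅m * z, n * w⁆ = ⁅m, n⁆ := by
    rw [commutatorElement_def, commutatorElement_def, mul_inv_rev, mul_inv_rev]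
    calc m * z * (n * w) * (z⁻¹ * m⁻¹) * (w⁻¹ * n⁻¹)
        = m * (z * (n * w) * z⁻¹) * m⁻¹ * (w⁻¹ * n⁻¹) := by group
      _ = m * (n * w) * m⁻¹ * (w⁻¹ * n⁻¹) := by rw [← hz' (n * w)]; group
      _ = m * n * (w * m⁻¹ * w⁻¹) * n⁻¹ := by group
      _ = m * n * m⁻¹ * n⁻¹ := by rw [← hw' m⁻¹]; group
  rw [e]
  exact mul_mem (mul_mem (mul_mem hm hn) (inv_mem hm)) (inv_mem hn)

theorem frattini_eq_bot_of_prime_card {H : Type*} [Group H] {p : ℕ} [Fact p.Prime]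
    (h : Nat.card H = p) : frattini H = ⊥ := by
  refine le_bot_iff.mp (frattini_le_coatom ⟨fun hb ↦ ?_, fun K hK ↦ ?_⟩)
  · have : Nat.card (⊤ : Subgroup H) = 1 := by rw [← hb, card_bot]
    rw [card_top, h] at this
    exact (Fact.out : p.Prime).ne_one this
  · have : Fact (Nat.card H).Prime := h ▸ inferInstance
    exact (K.eq_bot_or_eq_top_of_prime_card).resolve_left hK.ne'

theorem frattini_prod_eq_bot {H K : Type*} [Group H] [Group K] (hH : frattini H = ⊥)
    (hK : frattini K = ⊥) : frattini (H × K) = ⊥ := by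
  refine le_bot_iff.mp fun x hx ↦ ?_
  have h1 := frattini_le_comap_frattini_of_surjective
    (φ := MonoidHom.fst H K) Prod.fst_surjective hx
  have h2 := frattini_le_comap_frattini_of_surjective
    (φ := MonoidHom.snd H K) Prod.snd_surjective hx
  rw [hH, mem_comap, mem_bot] at h1
  rw [hK, mem_comap, mem_bot] at h2
  exact Prod.ext h1 h2

variable {E : Type*} [Group E] {p : ℕ} [Fact p.Prime]

/-- The centre of a nontrivial `p`-group is nontrivial; order `p²` or `p³` would make the quotient
by it cyclic, hence `E` commutative. -/
theorem center_card_eq_of_card_eq_cube (hE : Nat.card E = p ^ 3) (hne : commutator E ≠ ⊥) :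
    Nat.card (center E) = p := by
  have hp : p.Prime := Fact.out
  have : Finite E := Nat.finite_of_card_ne_zero (hE ▸ (pow_pos hp.pos 3).ne')
  have hnc : ¬ IsCyclic (E ⧸ center E) := fun h ↦ by
    have hc := isMulCommutative_of_isCyclic_quotient_center_self (G := E)
    refine hne (le_bot_iff.mp (commutator_le.mpr fun a _ b _ ↦ ?_))
    rw [mem_bot, commutatorElement_eq_one_iff_mul_comm]
    exact hc.is_comm.comm a b
  have hnt : Nontrivial E := Finite.one_lt_card_iff_nontrivial.mp
    (hE ▸ Nat.one_lt_pow (by norm_num) hp.one_lt)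
  have hnz : Nontrivial (center E) := (IsPGroup.of_card hE).center_nontrivial
  obtain ⟨k, hk, hkc⟩ := (Nat.dvd_prime_pow hp).mp (hE ▸ card_subgroup_dvd_card (center E))
  have hmul := card_eq_card_quotient_mul_card_subgroup (center E)
  rw [hE, hkc] at hmul
  interval_cases k
  · exact absurd hkc (Finite.one_lt_card_iff_nontrivial.mpr hnz).ne'
  · simpa using hkc
  · have : Nat.card (E ⧸ center E) = p :=
      (Nat.eq_of_mul_eq_mul_right (pow_pos hp.pos 2) (by rw [← hmul]; ring))
    exact absurd (isCyclic_of_prime_card this) hnc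
  · have : Nat.card (E ⧸ center E) = 1 :=
      (Nat.eq_of_mul_eq_mul_right (pow_pos hp.pos 3) (by rw [← hmul]; ring))
    have := (Nat.card_eq_one_iff_unique.mp this).1
    exact absurd isCyclic_of_subsingleton hnc

/-- A central extension of `(ℤ/p)²` by a group of order `p` inside the commutator subgroup is
extra-special. -/
theorem isExtraSpecialGroup_of_central_extension
    (π : E →* Multiplicative (ZMod p) × Multiplicative (ZMod p)) (hE : Nat.card E = p ^ 3)
    (hker : Nat.card π.ker = p) (hcen : π.ker ≤ center E) (hcom : π.ker ≤ commutator E) :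
    Function.Surjective π → IsExtraSpecialGroup p E := by
  intro hsurj
  have hp : p.Prime := Fact.out
  have : Finite E := Nat.finite_of_card_ne_zero (hE ▸ (pow_pos hp.pos 3).ne')
  have hne : commutator E ≠ ⊥ := fun h ↦ by
    rw [le_bot_iff.mp (hcom.trans_eq h), card_bot] at hker
    exact hp.one_lt.ne hker
  have hz := center_card_eq_of_card_eq_cube hE hne
  have e1 : π.ker = center E := eq_of_le_of_card_ge hcen (by rw [hz, hker])
  have e2 : π.ker = commutator E := le_antisymm hcom (Abelianization.commutator_subset_ker π)
  have hfr : frattini (Multiplicative (ZMod p)) = ⊥ :=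
    frattini_eq_bot_of_prime_card (p := p) (by simp)
  have e3 : π.ker = frattini E := le_antisymm
    ((le_inf hcen hcom).trans (center_inf_commutator_le_frattini E))
    (by
      have := frattini_le_comap_frattini_of_surjective hsurj
      rwa [frattini_prod_eq_bot hfr hfr] at this)
  exact ⟨⟨IsPGroup.of_card hE, e1.symm.trans e2, e1.symm.trans e3⟩, isCyclic_of_prime_card hz⟩

end Frattini

/-! ### The Heisenberg group and its characterisation -/

/-- The group of upper unitriangular `3 × 3` matrices over `ℤ/n`, with `fst` and `snd` the entries
next to the diagonal. -/
@[ext]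
structure Heisenberg (n : ℕ) where
  /-- The upper entry next to the diagonal. -/
  fst : ZMod n
  /-- The lower entry next to the diagonal. -/
  snd : ZMod n
  /-- The corner entry. -/
  corner : ZMod n

namespace Heisenberg

variable {n : ℕ}

instance : Mul (Heisenberg n) :=
  ⟨fun g h ↦ ⟨g.fst + h.fst, g.snd + h.snd, g.corner + h.corner + g.fst * h.snd⟩⟩

instance : One (Heisenberg n) := ⟨⟨0, 0, 0⟩⟩

instance : Inv (Heisenberg n) := ⟨fun g ↦ ⟨-g.fst, -g.snd, g.fst * g.snd - g.corner⟩⟩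

@[simp] theorem mul_fst (g h : Heisenberg n) : (g * h).fst = g.fst + h.fst := rfl
@[simp] theorem mul_snd (g h : Heisenberg n) : (g * h).snd = g.snd + h.snd := rfl
@[simp] theorem mul_corner (g h : Heisenberg n) :
    (g * h).corner = g.corner + h.corner + g.fst * h.snd := rfl
@[simp] theorem one_fst : (1 : Heisenberg n).fst = 0 := rfl
@[simp] theorem one_snd : (1 : Heisenberg n).snd = 0 := rfl
@[simp] theorem one_corner : (1 : Heisenberg n).corner = 0 := rfl
@[simp] theorem inv_fst (g : Heisenberg n) : g⁻¹.fst = -g.fst := rfl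
@[simp] theorem inv_snd (g : Heisenberg n) : g⁻¹.snd = -g.snd := rfl
@[simp] theorem inv_corner (g : Heisenberg n) : g⁻¹.corner = g.fst * g.snd - g.corner := rfl

instance : Group (Heisenberg n) :=
  Group.ofLeftAxioms (fun a b c ↦ by ext <;> simp <;> ring) (fun a ↦ by ext <;> simp)
    (fun a ↦ by ext <;> simp)

/-- The entries next to the diagonal, as a homomorphism. -/
def toProd (n : ℕ) : Heisenberg n →* Multiplicative (ZMod n) × Multiplicative (ZMod n) where
  toFun g := (.ofAdd g.fst, .ofAdd g.snd)
  map_one' := rfl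
  map_mul' _ _ := rfl

theorem toProd_eq_one_iff {g : Heisenberg n} : toProd n g = 1 ↔ g.fst = 0 ∧ g.snd = 0 :=
  Prod.ext_iff

theorem toProd_surjective : Function.Surjective (toProd n) :=
  fun x ↦ ⟨⟨x.1.toAdd, x.2.toAdd, 0⟩, rfl⟩

theorem ker_toProd_le_center : (toProd n).ker ≤ Subgroup.center (Heisenberg n) := fun g hg ↦ by
  obtain ⟨h1, h2⟩ := toProd_eq_one_iff.mp hg
  refine Subgroup.mem_center_iff.mpr fun h ↦ ?_
  ext <;> simp [h1, h2, add_comm]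

theorem commutatorElement_eq (g h : Heisenberg n) :
    ⁅g, h⁆ = ⟨0, 0, g.fst * h.snd - h.fst * g.snd⟩ := by
  rw [commutatorElement_def]
  ext <;> simp
  ring

/-- The entries of a unitriangular matrix. -/
def equivProd (n : ℕ) : Heisenberg n ≃ ZMod n × ZMod n × ZMod n where
  toFun g := (g.fst, g.snd, g.corner)
  invFun x := ⟨x.1, x.2.1, x.2.2⟩
  left_inv _ := rfl
  right_inv _ := rfl

theorem card (n : ℕ) : Nat.card (Heisenberg n) = n ^ 3 := by
  rw [Nat.card_congr (equivProd n), Nat.card_prod, Nat.card_prod, Nat.card_zmod]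
  ring

variable {E : Type*} [Group E]

theorem pow_val_add [NeZero n] {x : E} (hx : x ^ n = 1) (i j : ZMod n) :
    x ^ (i + j).val = x ^ i.val * x ^ j.val := by
  rw [ZMod.val_add, ← pow_eq_pow_mod _ hx, pow_add]

theorem pow_val_mul [NeZero n] {x : E} (hx : x ^ n = 1) (i j : ZMod n) :
    x ^ (i * j).val = x ^ (i.val * j.val) := by
  rw [ZMod.val_mul, ← pow_eq_pow_mod _ hx]

/-- Each of the `i * j` exchanges of an `x` with a `y` releases one `z`. -/
theorem pow_mul_pow_eq {x y z : E} (hzx : Commute z x) (hzy : Commute z y)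
    (h : x * y = y * x * z) (i j : ℕ) : x ^ i * y ^ j = y ^ j * x ^ i * z ^ (i * j) := by
  have h1 (i : ℕ) : x ^ i * y = y * x ^ i * z ^ i := by
    induction i with
    | zero => simp
    | succ i ih =>
      rw [pow_succ', mul_assoc, ih, ← mul_assoc, ← mul_assoc, h, mul_assoc (y * x) z,
        (hzx.pow_right i).eq, pow_succ' z]
      simp only [mul_assoc]
  induction j with
  | zero => simp
  | succ j ih =>
    rw [pow_succ, ← mul_assoc, ih, mul_assoc (y ^ j * x ^ i), (hzy.pow_left (i * j)).eq,
      ← mul_assoc, mul_assoc (y ^ j), h1, Nat.mul_succ, Nat.add_comm, pow_add z]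
    simp only [mul_assoc]

/-- The homomorphism from the Heisenberg group given by two elements whose commutator commutes with
both. -/
def lift [NeZero n] (x y z : E) (hx : x ^ n = 1) (hy : y ^ n = 1) (hz : z ^ n = 1)
    (hzx : Commute z x) (hzy : Commute z y) (h : x * y = y * x * z) : Heisenberg n →* E :=
  -- In the order `y`, `x`, `z` the exponents are exactly the matrix entries: the product of the
  -- lower and then the upper elementary matrix has corner `0`.
  MonoidHom.mk' (fun g ↦ y ^ g.snd.val * x ^ g.fst.val * z ^ g.corner.val) fun g k ↦ by
    simp only [mul_fst, mul_snd, mul_corner, pow_val_add hx, pow_val_add hy, pow_val_add hz,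
      pow_val_mul hz]
    set a := g.fst.val
    set b := k.snd.val
    have e1 : z ^ g.corner.val * (y ^ b * x ^ k.fst.val) =
        y ^ b * x ^ k.fst.val * z ^ g.corner.val :=
      ((hzy.pow_pow _ _).mul_right (hzx.pow_pow _ _)).eq
    have e2 : x ^ a * y ^ b = y ^ b * x ^ a * z ^ (a * b) := pow_mul_pow_eq hzx hzy h a b
    have e3 : z ^ (a * b) * (x ^ k.fst.val * (z ^ g.corner.val * z ^ k.corner.val)) =
        x ^ k.fst.val * (z ^ g.corner.val * z ^ k.corner.val) * z ^ (a * b) :=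
      ((hzx.pow_pow _ _).mul_right
        ((Commute.pow_pow_self z _ _).mul_right (Commute.pow_pow_self z _ _))).eq
    symm
    calc y ^ g.snd.val * x ^ a * z ^ g.corner.val * (y ^ b * x ^ k.fst.val * z ^ k.corner.val)
        = y ^ g.snd.val * x ^ a * (z ^ g.corner.val * (y ^ b * x ^ k.fst.val)) *
            z ^ k.corner.val := by simp only [mul_assoc]
      _ = y ^ g.snd.val * (x ^ a * y ^ b) * x ^ k.fst.val *
            (z ^ g.corner.val * z ^ k.corner.val) := by rw [e1]; simp only [mul_assoc]
      _ = y ^ g.snd.val * (y ^ b * x ^ a) * (z ^ (a * b) * (x ^ k.fst.val *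
            (z ^ g.corner.val * z ^ k.corner.val))) := by rw [e2]; simp only [mul_assoc]
      _ = _ := by rw [e3]; simp only [mul_assoc]

theorem lift_corner [NeZero n] (x y z : E) (hx : x ^ n = 1) (hy : y ^ n = 1) (hz : z ^ n = 1)
    (hzx : Commute z x) (hzy : Commute z y) (h : x * y = y * x * z) (c : ZMod n) :
    lift x y z hx hy hz hzx hzy h ⟨0, 0, c⟩ = z ^ c.val := by
  simp [lift]

theorem lift_injective {p : ℕ} [Fact p.Prime] (x y z : E) (hx : x ^ p = 1) (hy : y ^ p = 1)
    (hz : z ^ p = 1) (hzx : Commute z x) (hzy : Commute z y) (h : x * y = y * x * z)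
    (hz1 : z ≠ 1) : Function.Injective (lift x y z hx hy hz hzx hzy h) := by
  set f := lift x y z hx hy hz hzx hzy h with hf
  have hc (c : ZMod p) (hc : f ⟨0, 0, c⟩ = 1) : c = 0 := by
    rw [hf, lift_corner] at hc
    have := orderOf_dvd_of_pow_eq_one hc
    rw [orderOf_eq_prime hz hz1] at this
    exact (ZMod.val_eq_zero c).mp (Nat.eq_zero_of_dvd_of_lt this c.val_lt)
  refine (injective_iff_map_eq_one f).mpr fun g hg ↦ ?_
  -- Commutators with `g` stay in the kernel of `f` and lie in the corner, where `f` is injective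
  -- because `z` has order `p`; hence `g` is central.
  have hg' (k : Heisenberg p) : g.fst * k.snd - k.fst * g.snd = 0 := by
    apply hc
    rw [← commutatorElement_eq, map_commutatorElement, hg, commutatorElement_one_left]
  have h1 : g.fst = 0 := by simpa using hg' ⟨0, 1, 0⟩
  have h2 : g.snd = 0 := by simpa using hg' ⟨1, 0, 0⟩
  have h0 : g = ⟨0, 0, g.corner⟩ := Heisenberg.ext h1 h2 rfl
  rw [h0] at hg
  rw [h0, hc _ hg]
  rfl

/-- A group of order `p³`, of exponent `p` and of nilpotency class two is the Heisenberg group. -/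
theorem nonempty_mulEquiv {p : ℕ} [Fact p.Prime] (hcard : Nat.card E = p ^ 3)
    (hexp : ∀ e : E, e ^ p = 1) (hcen : commutator E ≤ Subgroup.center E)
    (hne : commutator E ≠ ⊥) : Nonempty (Heisenberg p ≃* E) := by
  -- The inverses are chosen so that `x * y = y * x * ⁅x⁻¹, y⁻¹⁆`, the form of relation that `lift`
  -- needs.
  obtain ⟨x, y, hxy⟩ : ∃ x y : E, ⁅x⁻¹, y⁻¹⁆ ≠ 1 := by
    by_contra! hcon
    refine hne (le_bot_iff.mp (Subgroup.commutator_le.mpr fun a _ b _ ↦ ?_))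
    simpa using hcon a⁻¹ b⁻¹
  have hz : ⁅x⁻¹, y⁻¹⁆ ∈ Subgroup.center E :=
    hcen (Subgroup.commutator_mem_commutator (Subgroup.mem_top _) (Subgroup.mem_top _))
  have hzc := Subgroup.mem_center_iff.mp hz
  have hinj := lift_injective x y ⁅x⁻¹, y⁻¹⁆ (hexp _) (hexp _) (hexp _) (hzc x).symm (hzc y).symm
    (by rw [commutatorElement_def]; group) hxy
  have : Finite E := Nat.finite_of_card_ne_zero
    (hcard ▸ (pow_pos (Fact.out : p.Prime).pos 3).ne')
  exact ⟨MulEquiv.ofBijective _ ((Nat.bijective_iff_injective_and_card _).mpr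
    ⟨hinj, by rw [card, hcard]⟩)⟩

end Heisenberg

/-! ### Commutators in central extensions of abelian groups -/

section ClassTwo

variable {Q G : Type*} [Group Q] [CommGroup G] {φ : Q →* G}

theorem commutatorElement_mem_center_of_ker_le_center
    (hφ : φ.ker ≤ Subgroup.center Q) (g h : Q) : ⁅g, h⁆ ∈ Subgroup.center Q :=
  hφ (by rw [MonoidHom.mem_ker, map_commutatorElement, commutatorElement_eq_one_iff_mul_comm,
    mul_comm])

/-- In a central extension of a commutative group, the commutator with a fixed element is a
homomorphism. -/
def commutatorHom (hφ : φ.ker ≤ Subgroup.center Q) (g : Q) : Q →* Q :=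
  MonoidHom.mk' (fun f ↦ ⁅f, g⁆) fun a b ↦ by
    have hb := Subgroup.mem_center_iff.mp (commutatorElement_mem_center_of_ker_le_center hφ b g)
    rw [commutatorElement_mul_left_eq_conj_mul, hb a, mul_inv_cancel_right,
      hb ⁅a, g⁆]

theorem commutatorHom_apply (hφ : φ.ker ≤ Subgroup.center Q) (f g : Q) :
    commutatorHom hφ g f = ⁅f, g⁆ := rfl

theorem commutatorElement_eq_one_of_mem_center {z : Q} (hz : z ∈ Subgroup.center Q) (g : Q) :
    ⁅z, g⁆ = 1 :=
  commutatorElement_eq_one_iff_mul_comm.mpr (Subgroup.mem_center_iff.mp hz g).symm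

/-- Up to a central factor, which commutators ignore, `f` is a word in `x` and `y`; and `⁅·, g⁆` is
a homomorphism. -/
theorem commutatorElement_mem_of_generators (hφ : φ.ker ≤ Subgroup.center Q)
    {x y : Q} (hxy : Subgroup.closure {φ x, φ y} = ⊤) {S : Subgroup Q} {g : Q}
    (hx : ⁅x, g⁆ ∈ S) (hy : ⁅y, g⁆ ∈ S) (f : Q) : ⁅f, g⁆ ∈ S := by
  have hf : φ f ∈ Subgroup.closure (φ '' {x, y}) := by
    rw [Set.image_pair, hxy]; exact Subgroup.mem_top _
  rw [← MonoidHom.map_closure] at hf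
  obtain ⟨k, hk, hkf⟩ := hf
  have hle : Subgroup.closure {x, y} ≤ S.comap (commutatorHom hφ g) := by
    rw [Subgroup.closure_le]
    rintro _ (rfl | rfl)
    exacts [hx, hy]
  have hz : k⁻¹ * f ∈ Subgroup.center Q :=
    hφ (by rw [MonoidHom.mem_ker, map_mul, map_inv, hkf, inv_mul_cancel])
  have := map_mul (commutatorHom hφ g) k (k⁻¹ * f)
  rw [mul_inv_cancel_left, commutatorHom_apply hφ (k⁻¹ * f),
    commutatorElement_eq_one_of_mem_center hz, mul_one] at this
  rw [← commutatorHom_apply hφ, this]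
  exact hle hk

/-- In a central extension of a commutative group with two generators, the commutator subgroup is
generated by one commutator. -/
theorem commutator_le_zpowers (hφ : φ.ker ≤ Subgroup.center Q) {x y : Q}
    (hxy : Subgroup.closure {φ x, φ y} = ⊤) : commutator Q ≤ Subgroup.zpowers ⁅x, y⁆ := by
  have hyx : ⁅y, x⁆ ∈ Subgroup.zpowers ⁅x, y⁆ := by
    rw [← commutatorElement_inv x y]
    exact inv_mem (Subgroup.mem_zpowers _)
  have h1 (f : Q) : ⁅f, x⁆ ∈ Subgroup.zpowers ⁅x, y⁆ :=
    commutatorElement_mem_of_generators hφ hxy (by simp) hyx f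
  have h2 (f : Q) : ⁅f, y⁆ ∈ Subgroup.zpowers ⁅x, y⁆ :=
    commutatorElement_mem_of_generators hφ hxy (Subgroup.mem_zpowers _) (by simp) f
  refine Subgroup.commutator_le.mpr fun f _ g _ ↦
    commutatorElement_mem_of_generators hφ hxy ?_ ?_ f
  · rw [← commutatorElement_inv g x]; exact inv_mem (h1 g)
  · rw [← commutatorElement_inv g y]; exact inv_mem (h2 g)

theorem commutatorElement_pow_eq_one (hφ : φ.ker ≤ Subgroup.center Q) {x : Q} {n : ℕ}
    (hx : φ x ^ n = 1) (y : Q) : ⁅x, y⁆ ^ n = 1 := by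
  rw [← commutatorHom_apply hφ, ← map_pow, commutatorHom_apply]
  exact commutatorElement_eq_one_of_mem_center (hφ (by rw [MonoidHom.mem_ker, map_pow, hx])) y

theorem commutatorElement_inv_inv (hφ : φ.ker ≤ Subgroup.center Q) (x y : Q) :
    ⁅x⁻¹, y⁻¹⁆ = ⁅x, y⁆ := by
  rw [← commutatorHom_apply hφ, map_inv, commutatorHom_apply, commutatorElement_inv,
    ← commutatorHom_apply hφ, map_inv, commutatorHom_apply, commutatorElement_inv]

end ClassTwo

/-! ### The normal closure of `K(N, 2)` -/

section KTilde

variable {F G : Type*} [Group F] [CommGroup G]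

theorem mem_KGroup_two {h : Fin 2 → F} : h ∈ KGroup F 2 ↔ h 0 * h 1 ∈ commutator F := by
  rw [← Abelianization.ker_of, MonoidHom.mem_ker, map_mul]
  change ∏ i, Abelianization.of (h i) = 1 ↔ _
  rw [Fin.prod_univ_two]

theorem vecCons_inv_mem_KClosure {N : Subgroup F} {n : F} (hn : n ∈ N) :
    ![n, n⁻¹] ∈ KClosure N 2 := by
  refine Subgroup.subset_normalClosure ⟨![⟨n, hn⟩, ⟨n, hn⟩⁻¹], ?_, ?_⟩
  · exact mem_KGroup_two.mpr (by simp)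
  · ext i; fin_cases i <;> rfl

/-- The inclusion of the second factor of `F ^ 2`. -/
def secondFactor (F : Type*) [Group F] : F →* (Fin 2 → F) :=
  MonoidHom.mk' (fun c ↦ ![1, c]) fun a b ↦ by
    ext i
    fin_cases i <;> simp

theorem secondFactor_apply (c : F) : secondFactor F c = ![1, c] := rfl

/-- Conjugating `(n⁻¹, n)` by `(1, f)` and multiplying by `(n, n⁻¹)` gives `(1, ⁅f, n⁆)`. -/
theorem secondFactor_commutatorElement_mem {N : Subgroup F} {n : F} (hn : n ∈ N) (f : F) :
    secondFactor F ⁅f, n⁆ ∈ KClosure N 2 := by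
  have h1 := vecCons_inv_mem_KClosure (inv_mem hn)
  have h2 := vecCons_inv_mem_KClosure hn
  have h3 := mul_mem ((KClosure_normal N 2).conj_mem _ h1 (secondFactor F f)) h2
  convert h3 using 1
  ext i
  fin_cases i <;> simp [secondFactor_apply, commutatorElement_def]

theorem KClosure_ker_le (φ : F →* G) (i : Fin 2) :
    KClosure φ.ker 2 ≤ (φ.comp (Pi.evalMonoidHom _ i)).ker := by
  refine Subgroup.normalClosure_le_normal ?_
  rintro _ ⟨x, -, rfl⟩
  exact (x i).2

/-- This is the test for elements outside the normal closure. As `ψ` makes the kernel of `φ`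
central, it does not see conjugation and kills commutators of that kernel; centrality also makes `h
↦ ψ (h 0) * ψ (h 1)` multiplicative on the closure. -/
theorem map_mul_eq_one_of_mem_KClosure {H : Type*} [Group H] {φ : F →* G} (ψ : F →* H)
    (hψ : φ.ker ≤ (Subgroup.center H).comap ψ) {h : Fin 2 → F} (hh : h ∈ KClosure φ.ker 2) :
    ψ (h 0) * ψ (h 1) = 1 := by
  have hcen (i) (k : Fin 2 → F) (hk : k ∈ KClosure φ.ker 2) (g : H) : g * ψ (k i) = ψ (k i) * g :=
    Subgroup.mem_center_iff.mp (hψ (KClosure_ker_le φ i hk)) g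
  refine Subgroup.closure_induction (p := fun k _ ↦ ψ (k 0) * ψ (k 1) = 1) ?_ (by simp) ?_ ?_ hh
  · intro k hk
    obtain ⟨_, ⟨x, hx, rfl⟩, hk⟩ := Group.mem_conjugatesOfSet_iff.mp hk
    obtain ⟨c, rfl⟩ := isConj_iff.mp hk
    have hc (i : Fin 2) : ψ ((c * (φ.ker.subtype.compLeft (Fin 2)) x * c⁻¹) i) = ψ (x i) := by
      have := Subgroup.mem_center_iff.mp (hψ (x i).2) (ψ (c i))
      change ψ (c i * x i * (c i)⁻¹) = _
      rw [map_mul, map_mul, map_inv, this, mul_inv_cancel_right]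
    rw [hc, hc, ← map_mul]
    have hx' := mem_KGroup_two.mp hx
    have hle : commutator φ.ker ≤ (ψ.comp φ.ker.subtype).ker := by
      refine Subgroup.commutator_le.mpr fun a _ b _ ↦ ?_
      rw [MonoidHom.mem_ker, map_commutatorElement]
      exact commutatorElement_eq_one_of_mem_center (hψ a.2) _
    exact hle hx'
  · intro a b ha hb ea eb
    have := hcen 0 b hb (ψ (a 1))
    simp only [Pi.mul_apply, map_mul]
    calc ψ (a 0) * ψ (b 0) * (ψ (a 1) * ψ (b 1))
        = ψ (a 0) * (ψ (b 0) * ψ (a 1)) * ψ (b 1) := by simp only [mul_assoc]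
      _ = (ψ (a 0) * ψ (a 1)) * (ψ (b 0) * ψ (b 1)) := by
        rw [← this]; simp only [mul_assoc]
      _ = 1 := by rw [ea, eb, mul_one]
  · intro a ha ea
    have := hcen 0 a ha (ψ (a 1))
    simp only [Pi.inv_apply, map_inv]
    rw [← mul_inv_rev, this, ea, inv_one]

/-- The elements of `F` whose copy in the second factor dies in `K̃(G, 2)`. -/
def secondFactorKernel (φ : F →* G) : Subgroup F :=
  (KClosure φ.ker 2).comap (secondFactor F)

instance (φ : F →* G) : (secondFactorKernel φ).Normal :=
  (KClosure_normal φ.ker 2).comap _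

/-- The homomorphism to `G` from the quotient of `F` by `secondFactorKernel`. -/
def secondFactorQuotientHom (φ : F →* G) : F ⧸ secondFactorKernel φ →* G :=
  QuotientGroup.lift _ φ fun _ hc ↦ KClosure_ker_le φ 1 hc

theorem ker_secondFactorQuotientHom_le_center (φ : F →* G) :
    (secondFactorQuotientHom φ).ker ≤ Subgroup.center _ := by
  intro n
  induction n using QuotientGroup.induction_on with
  | H n =>
    intro hn
    refine Subgroup.mem_center_iff.mpr fun f ↦ ?_
    induction f using QuotientGroup.induction_on with
    | H f =>
      rw [← commutatorElement_eq_one_iff_mul_comm]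
      exact (QuotientGroup.eq_one_iff ⁅f, n⁆).mpr 
        (secondFactor_commutatorElement_mem (N := φ.ker) hn f)

/-! ### The central extension `K̃(G, 2) → G` and its kernel -/

namespace KTilde

variable (φ : F →* G)

/-- The projection `K(F, 2) → K̃(G, 2)`. -/
def mk : KGroup F 2 →* KTilde φ 2 := QuotientGroup.mk' _

theorem mk_surjective : Function.Surjective (mk φ) := QuotientGroup.mk'_surjective _

theorem mk_eq_one_iff (h : KGroup F 2) : mk φ h = 1 ↔ (h : Fin 2 → F) ∈ KClosure φ.ker 2 :=
  QuotientGroup.eq_one_iff h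

/-- The homomorphism `K̃(G, 2) → G` given by the first component. -/
def proj : KTilde φ 2 →* G :=
  QuotientGroup.lift _ ((φ.comp (Pi.evalMonoidHom (fun _ ↦ F) 0)).comp (KGroup F 2).subtype)
    fun _ hc ↦ KClosure_ker_le φ 0 hc

theorem proj_mk (h : KGroup F 2) : proj φ (mk φ h) = φ (h.1 0) := rfl

/-- The antidiagonal pair `(a, a⁻¹)`, an element of `K(F, 2)`. -/
def antidiag (a : F) : KGroup F 2 := ⟨![a, a⁻¹], mem_KGroup_two.mpr (by simp)⟩

theorem antidiag_pow (a : F) (n : ℕ) : antidiag a ^ n = antidiag (a ^ n) := by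
  ext i
  fin_cases i <;> simp [antidiag]

theorem proj_surjective (hφ : Function.Surjective φ) : Function.Surjective (proj φ) := fun g ↦ by
  obtain ⟨a, rfl⟩ := hφ g
  exact ⟨mk φ (antidiag a), rfl⟩

theorem mk_antidiag_eq_one {n : F} (hn : φ n = 1) : mk φ (antidiag n) = 1 :=
  (mk_eq_one_iff φ _).mpr (vecCons_inv_mem_KClosure hn)

/-- The homomorphism `[F, F] → K̃(G, 2)` given by the second component. -/
def ofCommutator : commutator F →* KTilde φ 2 :=
  (mk φ).comp (((secondFactor F).comp (commutator F).subtype).codRestrict (KGroup F 2)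
    fun c ↦ mem_KGroup_two.mpr (by simp [secondFactor_apply]))

theorem ofCommutator_apply (c : commutator F) : ofCommutator φ c =
    mk φ ⟨secondFactor F c, mem_KGroup_two.mpr (by simp [secondFactor_apply])⟩ := rfl

theorem ofCommutator_eq_one_iff (c : commutator F) :
    ofCommutator φ c = 1 ↔ (c : F) ∈ secondFactorKernel φ :=
  mk_eq_one_iff φ _

theorem ofCommutator_eq_iff (c d : commutator F) : ofCommutator φ c = ofCommutator φ d ↔
    (c : F ⧸ secondFactorKernel φ) = d := by
  rw [eq_comm, QuotientGroup.eq, ← inv_mul_eq_one, eq_comm, ← map_inv, ← map_mul, eq_comm,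
    ← Subgroup.coe_inv, ← Subgroup.coe_mul, ← ofCommutator_eq_one_iff]
  rw [← inv_eq_one, ← map_inv, mul_inv_rev, inv_inv]

/-- The quotient of the two representatives is `(h₀⁻¹, h₁⁻¹ h₀ h₁)`, the conjugate of `(h₀⁻¹, h₀)`
by `(1, h₁⁻¹)`. -/
theorem mk_eq_ofCommutator (h : KGroup F 2) (h0 : φ (h.1 0) = 1) :
    mk φ h = ofCommutator φ ⟨h.1 0 * h.1 1, mem_KGroup_two.mp h.2⟩ := by
  rw [← inv_mul_eq_one, ofCommutator_apply, ← map_inv, ← map_mul, mk_eq_one_iff]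
  have h1 := vecCons_inv_mem_KClosure (N := φ.ker) (n := (h.1 0)⁻¹)
    (by rw [MonoidHom.mem_ker, map_inv, h0, inv_one])
  convert (KClosure_normal φ.ker 2).conj_mem _ h1 (secondFactor F (h.1 1)⁻¹) using 1
  ext i
  fin_cases i <;> simp [secondFactor_apply, mul_assoc]

theorem exists_ofCommutator_of_mem_ker {e : KTilde φ 2} (he : e ∈ (proj φ).ker) :
    ∃ c, ofCommutator φ c = e := by
  obtain ⟨h, rfl⟩ := mk_surjective φ e
  exact ⟨_, (mk_eq_ofCommutator φ h he).symm⟩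

theorem ker_proj_le_center : (proj φ).ker ≤ Subgroup.center (KTilde φ 2) := by
  intro e he
  obtain ⟨c, rfl⟩ := exists_ofCommutator_of_mem_ker φ he
  refine Subgroup.mem_center_iff.mpr fun k ↦ ?_
  obtain ⟨h, rfl⟩ := mk_surjective φ k
  rw [← commutatorElement_eq_one_iff_mul_comm, ofCommutator_apply, ← map_commutatorElement,
    mk_eq_one_iff]
  -- The commutator of `h` with `(1, c)` is `(1, ⁅h₁, c⁆)`, and `c` lies in the kernel of `φ`
  -- because `G` is commutative.
  convert secondFactor_commutatorElement_mem (N := φ.ker)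
    (Abelianization.commutator_subset_ker φ c.2) (h.1 1) using 1
  ext i
  fin_cases i <;> simp [secondFactor_apply, commutatorElement_def]

/-- The element `(1, [x, y])` of `K̃(G, 2)`. -/
def commutatorClass (x y : F) : KTilde φ 2 :=
  ofCommutator φ ⟨⁅x, y⁆,
    Subgroup.commutator_mem_commutator (Subgroup.mem_top _) (Subgroup.mem_top _)⟩

theorem ker_proj_le_zpowers {x y : F} (hxy : Subgroup.closure {φ x, φ y} = ⊤) :
    (proj φ).ker ≤ Subgroup.zpowers (commutatorClass φ x y) := by
  intro e he
  obtain ⟨c, rfl⟩ := exists_ofCommutator_of_mem_ker φ he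
  have hc : (c : F ⧸ secondFactorKernel φ) ∈ commutator (F ⧸ secondFactorKernel φ) := by
    have := Subgroup.mem_map_of_mem (QuotientGroup.mk' (secondFactorKernel φ)) c.2
    have hmap := Subgroup.map_commutator (⊤ : Subgroup F) ⊤
      (QuotientGroup.mk' (secondFactorKernel φ))
    exact Subgroup.commutator_mono le_top le_top (hmap.le this)
  obtain ⟨k, hk⟩ := commutator_le_zpowers (ker_secondFactorQuotientHom_le_center φ)
    (x := (x : F ⧸ secondFactorKernel φ)) (y := y) hxy hc
  refine ⟨k, ?_⟩
  change commutatorClass φ x y ^ k = _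
  rw [commutatorClass, ← map_zpow, ofCommutator_eq_iff, ← hk]
  rfl

theorem commutatorClass_mem_ker (x y : F) : commutatorClass φ x y ∈ (proj φ).ker :=
  map_one φ

theorem commutatorClass_pow {x : F} {n : ℕ} (hx : φ x ^ n = 1) (y : F) :
    commutatorClass φ x y ^ n = 1 := by
  rw [commutatorClass, ← map_pow, ← map_one (ofCommutator φ), ofCommutator_eq_iff]
  exact commutatorElement_pow_eq_one (ker_secondFactorQuotientHom_le_center φ)
    (x := (x : F ⧸ secondFactorKernel φ)) hx y

/-- The commutator is the class of `(⁅x, y⁆, ⁅x⁻¹, y⁻¹⁆)`. Moving the first component to the second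
factor gives `⁅x, y⁆ * ⁅x⁻¹, y⁻¹⁆`, and in class two both factors agree. -/
theorem commutatorElement_mk_antidiag (x y : F) :
    ⁅mk φ (antidiag x), mk φ (antidiag y)⁆ = commutatorClass φ x y ^ 2 := by
  rw [← map_commutatorElement, mk_eq_ofCommutator, commutatorClass, ← map_pow,
    ofCommutator_eq_iff]
  · have := commutatorElement_inv_inv (ker_secondFactorQuotientHom_le_center φ)
      (x : F ⧸ secondFactorKernel φ) y
    rw [Subgroup.coe_pow, QuotientGroup.mk_pow, pow_two]
    exact congrArg (⁅(x : F ⧸ secondFactorKernel φ), (y : F ⧸ secondFactorKernel φ)⁆ * ·) this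
  · change φ ⁅x, y⁆ = 1
    exact Abelianization.commutator_subset_ker φ
      (Subgroup.commutator_mem_commutator (Subgroup.mem_top _) (Subgroup.mem_top _))

theorem commutatorClass_mem_commutator {x : F} {n : ℕ} (hn : Odd n) (hx : φ x ^ n = 1) (y : F) :
    commutatorClass φ x y ∈ commutator (KTilde φ 2) := by
  obtain ⟨m, rfl⟩ := hn
  have h2 : commutatorClass φ x y ^ 2 ∈ commutator (KTilde φ 2) := by
    rw [← commutatorElement_mk_antidiag]
    exact Subgroup.commutator_mem_commutator (Subgroup.mem_top _) (Subgroup.mem_top _)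
  -- The order of the class divides the odd number `2m + 1`, so squaring is inverted by the power `m
  -- + 1`. For `n = p` this is where `p ≠ 2` matters.
  have h : commutatorClass φ x y = (commutatorClass φ x y ^ 2) ^ (m + 1) := by
    rw [← pow_mul, show 2 * (m + 1) = (2 * m + 1) + 1 by ring, pow_succ,
      commutatorClass_pow φ hx, one_mul]
  rw [h]
  exact pow_mem h2 _

theorem commutatorClass_ne_one {H : Type*} [Group H] (ψ : F →* H)
    (hψ : φ.ker ≤ (Subgroup.center H).comap ψ) {x y : F} (hxy : ⁅ψ x, ψ y⁆ ≠ 1) :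
    commutatorClass φ x y ≠ 1 := by
  rw [commutatorClass, Ne, ofCommutator_eq_one_iff]
  intro h
  have := map_mul_eq_one_of_mem_KClosure ψ hψ h
  rw [secondFactor_apply] at this
  simp only [Matrix.cons_val_zero, Matrix.cons_val_one, map_one, one_mul,
    map_commutatorElement] at this
  exact hxy this

/-- An element is some `(a, a⁻¹)` times a central element of the kernel of `proj`. The `n`-th power
of the first is `(aⁿ, a⁻ⁿ)`, which dies, and the kernel is generated by an element killed by `n`. -/
theorem pow_eq_one {x y : F} (hxy : Subgroup.closure {φ x, φ y} = ⊤) {n : ℕ}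
    (hG : ∀ g : G, g ^ n = 1) (e : KTilde φ 2) : e ^ n = 1 := by
  obtain ⟨h, rfl⟩ := mk_surjective φ e
  have hk : (mk φ (antidiag (h.1 0)))⁻¹ * mk φ h ∈ (proj φ).ker := by
    rw [MonoidHom.mem_ker, map_mul, map_inv, proj_mk, proj_mk]
    exact inv_mul_cancel _
  have hpow : ((mk φ (antidiag (h.1 0)))⁻¹ * mk φ h) ^ n = 1 := by
    obtain ⟨k, hk'⟩ := ker_proj_le_zpowers φ hxy hk
    rw [← hk']
    change (commutatorClass φ x y ^ k) ^ n = 1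
    rw [← zpow_natCast, zpow_comm, zpow_natCast, commutatorClass_pow φ (hG _), one_zpow]
  have hcomm : Commute (mk φ (antidiag (h.1 0))) ((mk φ (antidiag (h.1 0)))⁻¹ * mk φ h) :=
    Subgroup.mem_center_iff.mp (ker_proj_le_center φ hk) _
  have := hcomm.mul_pow n
  rwa [mul_inv_cancel_left, hpow, mul_one, ← map_pow (mk φ) (antidiag _), antidiag_pow,
    mk_antidiag_eq_one φ (by rw [map_pow, hG])] at this

end KTilde

/-- Homomorphisms from a free group lift along surjections. -/
theorem IsFreeGroup.exists_lift [IsFreeGroup F] {H K : Type*} [Group H] [Group K] (π : H →* K)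
    (hπ : Function.Surjective π) (φ : F →* K) : ∃ ψ : F →* H, π.comp ψ = φ := by
  choose s hs using hπ
  refine ⟨IsFreeGroup.lift fun x ↦ s (φ (IsFreeGroup.of x)), IsFreeGroup.ext_hom fun x ↦ ?_⟩
  rw [MonoidHom.comp_apply, IsFreeGroup.lift_of, hs]

/-! ### The cases `ℤ/p` and `(ℤ/p)²` -/

namespace KTilde

section Prime

variable {p : ℕ} [Fact p.Prime]

theorem proj_injective_of_isCyclic [IsCyclic G] {φ : F →* G} (hφ : Function.Surjective φ) :
    Function.Injective (proj φ) := by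
  obtain ⟨g, hg⟩ := IsCyclic.exists_generator (α := G)
  obtain ⟨x, rfl⟩ := hφ g
  -- Repeating the generator brings the cyclic case under the two-generator bound, with the trivial
  -- commutator `⁅x, x⁆`.
  have hx : Subgroup.closure {φ x, φ x} = ⊤ := by
    rw [Set.pair_eq_singleton, ← Subgroup.zpowers_eq_closure, Subgroup.eq_top_iff']
    exact hg
  have h1 : commutatorClass φ x x = 1 := by
    rw [commutatorClass, ofCommutator_eq_one_iff]
    simp [one_mem]
  have := ker_proj_le_zpowers φ hx
  rw [h1, Subgroup.zpowers_one_eq_bot, le_bot_iff] at this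
  exact (MonoidHom.ker_eq_bot_iff _).mp this

variable {φ : F →* Multiplicative (ZMod p) × Multiplicative (ZMod p)}

/-- Freeness of `F` is used here: `φ` lifts to the Heisenberg group, where the images of `x` and `y`
do not commute. -/
theorem commutatorClass_ne_one_of_basis [IsFreeGroup F] {x y : F} (hx : φ x = (.ofAdd 1, 1))
    (hy : φ y = (1, .ofAdd 1)) : commutatorClass φ x y ≠ 1 := by
  obtain ⟨ψ, hψ⟩ := IsFreeGroup.exists_lift (Heisenberg.toProd p) Heisenberg.toProd_surjective φ
  refine commutatorClass_ne_one φ ψ (fun n hn ↦ ?_) ?_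
  · refine Heisenberg.ker_toProd_le_center ?_
    rw [MonoidHom.mem_ker, ← MonoidHom.comp_apply, hψ]
    exact hn
  · have hx' : Heisenberg.toProd p (ψ x) = (.ofAdd 1, 1) := by
      rw [← hx, ← hψ, MonoidHom.comp_apply]
    have hy' : Heisenberg.toProd p (ψ y) = (1, .ofAdd 1) := by
      rw [← hy, ← hψ, MonoidHom.comp_apply]
    have e1 : (ψ x).fst = 1 := congrArg Prod.fst hx'
    have e2 : (ψ x).snd = 0 := congrArg Prod.snd hx'
    have e3 : (ψ y).fst = 0 := congrArg Prod.fst hy'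
    have e4 : (ψ y).snd = 1 := congrArg Prod.snd hy'
    rw [Heisenberg.commutatorElement_eq, e1, e2, e3, e4]
    intro h
    have := congrArg Heisenberg.corner h
    simp at this

theorem prod_zmod_pow (g : Multiplicative (ZMod p) × Multiplicative (ZMod p)) : g ^ p = 1 := by
  ext <;> simp

theorem ker_proj_eq_zpowers {x y : F} (hx : φ x = (.ofAdd 1, 1)) (hy : φ y = (1, .ofAdd 1)) :
    (proj φ).ker = Subgroup.zpowers (commutatorClass φ x y) :=
  le_antisymm (ker_proj_le_zpowers φ (by rw [hx, hy, closure_prod_zmod]))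
    (Subgroup.zpowers_le.mpr (commutatorClass_mem_ker φ x y))

theorem card_ker_proj [IsFreeGroup F] (hφ : Function.Surjective φ) : Nat.card (proj φ).ker = p := by
  obtain ⟨x, hx⟩ := hφ (.ofAdd 1, 1)
  obtain ⟨y, hy⟩ := hφ (1, .ofAdd 1)
  rw [ker_proj_eq_zpowers hx hy, Nat.card_zpowers,
    orderOf_eq_prime (commutatorClass_pow φ (prod_zmod_pow _) y)
      (commutatorClass_ne_one_of_basis hx hy)]

theorem ker_proj_le_commutator (hp : p ≠ 2) (hφ : Function.Surjective φ) :
    (proj φ).ker ≤ commutator (KTilde φ 2) := by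
  obtain ⟨x, hx⟩ := hφ (.ofAdd 1, 1)
  obtain ⟨y, hy⟩ := hφ (1, .ofAdd 1)
  rw [ker_proj_eq_zpowers hx hy, Subgroup.zpowers_le]
  exact commutatorClass_mem_commutator φ ((Fact.out : p.Prime).odd_of_ne_two hp)
    (prod_zmod_pow _) y

theorem card_eq [IsFreeGroup F] (hφ : Function.Surjective φ) : Nat.card (KTilde φ 2) = p ^ 3 := by
  rw [Subgroup.card_eq_card_quotient_mul_card_subgroup (proj φ).ker, card_ker_proj hφ,
    Nat.card_congr (QuotientGroup.quotientKerEquivOfSurjective _ (proj_surjective φ hφ)).toEquiv,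
    Nat.card_prod]
  simp
  ring

theorem pow_prime_eq_one (hφ : Function.Surjective φ) (e : KTilde φ 2) : e ^ p = 1 := by
  obtain ⟨x, hx⟩ := hφ (.ofAdd 1, 1)
  obtain ⟨y, hy⟩ := hφ (1, .ofAdd 1)
  exact pow_eq_one φ (x := x) (y := y) (by rw [hx, hy, closure_prod_zmod]) prod_zmod_pow e

end Prime

end KTilde

end KTilde

/-! ### Uniqueness of the extra-special group and conclusion -/

theorem IsExtraSpecialGroup.nonempty_heisenberg_mulEquiv {p : ℕ} [Fact p.Prime] {E : Type*}
    [Group E] (hE : IsExtraSpecialGroup p E) (hcard : Nat.card E = p ^ 3)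
    (hexp : Monoid.exponent E = p) : Nonempty (Heisenberg p ≃* E) := by
  refine Heisenberg.nonempty_mulEquiv hcard (fun e ↦ hexp ▸ Monoid.pow_exponent_eq_one e)
    hE.1.2.1.ge fun h ↦ ?_
  have hp : p.Prime := Fact.out
  have : Finite E := Nat.finite_of_card_ne_zero (hcard ▸ (pow_pos hp.pos 3).ne')
  have : Nontrivial E := Finite.one_lt_card_iff_nontrivial.mp
    (hcard ▸ Nat.one_lt_pow (by norm_num) hp.one_lt)
  have := (IsPGroup.of_card hcard).center_nontrivial
  rw [hE.1.2.1, h] at this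
  exact not_subsingleton _ (inferInstance : Subsingleton (⊥ : Subgroup E))

theorem proposition4p5 (p : ℕ) [Fact p.Prime] (hp : p ≠ 2) :
    (∀ (F : Type*) [Group F] [IsFreeGroup F] (φ : F →* Multiplicative (ZMod p)),
      Function.Surjective φ →
        IsCover (KTilde φ 2) (Multiplicative (ZMod p)) ∧
        Nonempty (KTilde φ 2 ≃* Multiplicative (ZMod p))) ∧
    (∀ (F : Type*) [Group F] [IsFreeGroup F]
      (φ : F →* Multiplicative (ZMod p) × Multiplicative (ZMod p)),
      Function.Surjective φ →
        IsCover (KTilde φ 2) (Multiplicative (ZMod p) × Multiplicative (ZMod p)) ∧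
        (IsExtraSpecialGroup p (KTilde φ 2) ∧ Nat.card (KTilde φ 2) = p ^ (1 + 2) ∧
          Monoid.exponent (KTilde φ 2) = p) ∧
        ∀ (E : Type*) [Group E], IsExtraSpecialGroup p E → Nat.card E = p ^ (1 + 2) →
          Monoid.exponent E = p → Nonempty (KTilde φ 2 ≃* E)) := by
  have hpp : p.Prime := Fact.out
  refine ⟨fun F _ _ φ hφ ↦ ?_, fun F _ _ φ hφ ↦ ?_⟩
  · have hinj := KTilde.proj_injective_of_isCyclic hφ
    have hker : (KTilde.proj φ).ker = ⊥ := (MonoidHom.ker_eq_bot_iff _).mpr hinj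
    have := subsingleton_schurMultiplier_of_isCyclic (G := Multiplicative (ZMod p))
    refine ⟨⟨KTilde.proj φ, KTilde.proj_surjective φ hφ, KTilde.ker_proj_le_center φ,
      hker ▸ bot_le, ?_⟩, ⟨MulEquiv.ofBijective _ ⟨hinj, KTilde.proj_surjective φ hφ⟩⟩⟩
    rw [hker]
    have : Unique (Multiplicative (SchurMultiplier (Multiplicative (ZMod p)))) :=
      ⟨⟨1⟩, fun _ ↦ Subsingleton.elim (α := SchurMultiplier _) _ _⟩
    exact ⟨MulEquiv.ofUnique⟩
  · have hcard := KTilde.card_eq hφ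
    have hextra := isExtraSpecialGroup_of_central_extension (KTilde.proj φ) hcard
      (KTilde.card_ker_proj hφ) (KTilde.ker_proj_le_center φ)
      (KTilde.ker_proj_le_commutator hp hφ) (KTilde.proj_surjective φ hφ)
    have hexp : Monoid.exponent (KTilde φ 2) = p := by
      refine ((Nat.dvd_prime hpp).mp (Monoid.exponent_dvd_of_forall_pow_eq_one
        (KTilde.pow_prime_eq_one hφ))).resolve_left fun h ↦ ?_
      have := Monoid.exp_eq_one_iff.mp h
      rw [Nat.card_of_subsingleton (1 : KTilde φ 2)] at hcard
      exact (Nat.one_lt_pow (by norm_num) hpp.one_lt).ne hcard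
    refine ⟨⟨KTilde.proj φ, KTilde.proj_surjective φ hφ, KTilde.ker_proj_le_center φ,
      KTilde.ker_proj_le_commutator hp hφ, ⟨mulEquivOfPrimeCardEq (p := p)
        (KTilde.card_ker_proj hφ) (card_schurMultiplier_prod_zmod p)⟩⟩,
      ⟨hextra, hcard, hexp⟩, fun E _ hE hEcard hEexp ↦ ?_⟩
    obtain ⟨e⟩ := hextra.nonempty_heisenberg_mulEquiv hcard hexp
    obtain ⟨e'⟩ := hE.nonempty_heisenberg_mulEquiv hEcard hEexp
    exact ⟨e.symm.trans e'⟩
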